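/- Let $r\ge 0$, let $\boldsymbol{\nu}=(\nu_0,\dots,\nu_r)$ be a vector of pairwise distinct and pairwise coprime positive integers, and let $\mathbf q=(q_0,\dots,q_r)$ be a vector of non-negative integers. Let $b_q(x):=B_q(\{x\})$ be the $q$-th periodic Bernoulli function, where $B_q$ is the $q$-th Bernoulli polynomial and $\{x\}=x-\lfloor x\rfloor$, and put $\Delta b_q:=b_q(1^-)-b_q(0^+)$ (one-sided limits). Define the Dedekind sums and the reciprocity $$S_{b_{\mathbf q}}(\boldsymbol{\nu}|\nu_k):=\sum_{i=1}^{\nu_k-1}\ \prod_{j\ne k} b_{q_j}\!\left(\frac{i\,\nu_j}{\nu_k}\right),\qquad \mathcal R_{b_{\mathbf q}}(\boldsymbol{\nu}):=\sum_{k=0}^r S_{b_{\mathbf q}}(\boldsymbol{\nu}|\nu_k)\,\Delta b_{q_k},$$ where an empty product equals $1$. If either $q_k>1$ for all $k=0,\dots,r$, or $|\mathbf q_k|:=\sum_{j\ne k}q_j$ is odd for all $k=0,\dots,r$, then $$\mathcal R_{b_{\mathbf q}}(\boldsymbol{\nu})=0.$$ -/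

import Mathlib

open scoped BigOperators

noncomputable section

/-- The `q`-th periodic Bernoulli function `b_q(x) = B_q({x})`, as a complex-valued function
on `ℝ`; here `bernoulliFun q` is the evaluation of the Bernoulli polynomial `B_q`
(so `B_1(x) = x - 1/2`). -/
def periodicBernoulli (q : ℕ) (x : ℝ) : ℂ :=
  ((bernoulliFun q (Int.fract x) : ℝ) : ℂ)

/-- The generalized Dedekind sum
`S_f(ν | ν_k) = ∑_{i=1}^{ν_k - 1} ∏_{j ≠ k} f_j (i ν_j / ν_k)`.
For `r = 0` the product is empty and the sum is `ν_0 - 1`. -/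
def dedekindSum {r : ℕ} (f : Fin (r + 1) → ℝ → ℂ) (ν : Fin (r + 1) → ℕ) (k : Fin (r + 1)) : ℂ :=
  ∑ i ∈ Finset.Ico 1 (ν k), ∏ j ∈ Finset.univ.erase k, f j ((i : ℝ) * (ν j : ℝ) / (ν k : ℝ))

/-- The jump `Δ f = f(1⁻) - f(0⁺)` of a `1`-periodic function, defined by one-sided limits. -/
def jump (f : ℝ → ℂ) : ℂ :=
  Function.leftLim f 1 - Function.rightLim f 0

/-- The reciprocity `R_f(ν) = ∑_k S_f(ν | ν_k) Δ f_k`. -/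
def reciprocity {r : ℕ} (f : Fin (r + 1) → ℝ → ℂ) (ν : Fin (r + 1) → ℕ) : ℂ :=
  ∑ k, dedekindSum f ν k * jump (f k)

end

/-! Each term of the reciprocity vanishes separately. Since `B_q(0) = B_q(1)` unless `q = 1`,
exponents above 1 kill every jump. In the odd case, `B_q(1 - x) = (-1)^q B_q(x)` makes each Dedekind
sum its own negative under `i ↦ ν_k - i`. -/

open Filter Topology in
/-- The jump of the periodic Bernoulli function at the integers. -/
theorem jump_periodicBernoulli (q : ℕ) :
    jump (periodicBernoulli q) = if q = 1 then 1 else 0 := by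
  have hcont : Continuous fun x : ℝ => ((bernoulliFun q x : ℝ) : ℂ) :=
    Complex.continuous_ofReal.comp (continuous_bernoulliFun q)
  have hfract : ∀ x ∈ Set.Ioo (0 : ℝ) 1,
      ((bernoulliFun q x : ℝ) : ℂ) = periodicBernoulli q x := fun x hx => by
    rw [periodicBernoulli, Int.fract_eq_self.2 ⟨hx.1.le, hx.2⟩]
  have hleft : Function.leftLim (periodicBernoulli q) 1 = ((bernoulliFun q 1 : ℝ) : ℂ) := by
    refine leftLim_eq_of_tendsto
      (((hcont.tendsto 1).mono_left nhdsWithin_le_nhds).congr' ?_)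
    filter_upwards [Ioo_mem_nhdsLT (zero_lt_one' ℝ)] using hfract
  have hright : Function.rightLim (periodicBernoulli q) 0 = ((bernoulliFun q 0 : ℝ) : ℂ) := by
    refine rightLim_eq_of_tendsto
      (((hcont.tendsto 0).mono_left nhdsWithin_le_nhds).congr' ?_)
    filter_upwards [Ioo_mem_nhdsGT (zero_lt_one' ℝ)] using hfract
  rw [jump, hleft, hright, bernoulliFun_eval_one]
  split_ifs <;> simp

/-- Away from the integers, `b_q` has the parity of `q`. -/
theorem periodicBernoulli_neg (q : ℕ) {x : ℝ} (hx : Int.fract x ≠ 0) :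
    periodicBernoulli q (-x) = (-1) ^ q * periodicBernoulli q x := by
  rw [periodicBernoulli, periodicBernoulli, Int.fract_neg hx, bernoulliFun_eval_one_sub]
  push_cast
  rfl

theorem periodicBernoulli_natCast_sub (q n : ℕ) (x : ℝ) :
    periodicBernoulli q (n - x) = periodicBernoulli q (-x) := by
  rw [periodicBernoulli, periodicBernoulli, sub_eq_add_neg, Int.fract_natCast_add]

/-- Keeps the arguments off the integers, where parity fails for `b_1`, as `b_1(0) = -1/2`. -/
theorem fract_mul_div_ne_zero {i m n : ℕ} (hi : 0 < i) (hin : i < n) (h : Nat.Coprime m n) :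
    Int.fract ((i : ℝ) * m / n) ≠ 0 := by
  rw [Ne, Int.fract_eq_zero_iff]
  rintro ⟨z, hz⟩
  have hn : (n : ℝ) ≠ 0 := by exact_mod_cast (hi.trans hin).ne'
  rw [eq_div_iff hn] at hz
  have hdvd : n ∣ i * m := by
    rw [← Int.natCast_dvd_natCast]
    exact ⟨z, by rw [mul_comm (n : ℤ)]; exact_mod_cast hz.symm⟩
  exact absurd (Nat.le_of_dvd hi (h.symm.dvd_of_dvd_mul_right hdvd)) hin.not_ge

/-- The substitution `i ↦ ν_k - i` multiplies a Dedekind sum of periodic Bernoulli functions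
by `(-1) ^ ∑_{j ≠ k} q_j`. -/
theorem dedekindSum_periodicBernoulli_reflect {r : ℕ} (ν q : Fin (r + 1) → ℕ)
    (hν : Pairwise fun j k => Nat.Coprime (ν j) (ν k)) (k : Fin (r + 1)) :
    dedekindSum (fun k => periodicBernoulli (q k)) ν k =
      (-1) ^ (∑ j ∈ Finset.univ.erase k, q j) *
        dedekindSum (fun k => periodicBernoulli (q k)) ν k := by
  have hmem : ∀ i ∈ Finset.Ico 1 (ν k), ν k - i ∈ Finset.Ico 1 (ν k) := fun i hi => by
    rw [Finset.mem_Ico] at hi ⊢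
    omega
  rw [dedekindSum, Finset.mul_sum]
  refine Finset.sum_bij' (fun i _ => ν k - i) (fun i _ => ν k - i) hmem hmem
    (fun i hi => by rw [Finset.mem_Ico] at hi; omega)
    (fun i hi => by rw [Finset.mem_Ico] at hi; omega) fun i hi => ?_
  rw [← Finset.prod_pow_eq_pow_sum, ← Finset.prod_mul_distrib]
  refine Finset.prod_congr rfl fun j hj => ?_
  have hi' := Finset.mem_Ico.1 (hmem i hi)
  have hik : i ≤ ν k := (Finset.mem_Ico.1 hi).2.le
  have hk : (ν k : ℝ) ≠ 0 := by
    have : ν k ≠ 0 := by omega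
    exact_mod_cast this
  -- With `x = (ν_k - i) ν_j / ν_k`, the sign turns `b(x)` into `b(-x)`; shifting by the integer
  -- `ν_j` gives `ν_j - x = i ν_j / ν_k`.
  rw [← periodicBernoulli_neg _
      (fract_mul_div_ne_zero hi'.1 hi'.2 (hν (Finset.ne_of_mem_erase hj))),
    ← periodicBernoulli_natCast_sub _ (ν j), Nat.cast_sub hik]
  congr 1
  field_simp
  ring

theorem dedekindSum_periodicBernoulli_eq_zero {r : ℕ} (ν q : Fin (r + 1) → ℕ)
    (hν : Pairwise fun j k => Nat.Coprime (ν j) (ν k)) (k : Fin (r + 1))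
    (hq : Odd (∑ j ∈ Finset.univ.erase k, q j)) :
    dedekindSum (fun k => periodicBernoulli (q k)) ν k = 0 := by
  have h := dedekindSum_periodicBernoulli_reflect ν q hν k
  rwa [hq.neg_one_pow, neg_one_mul, self_eq_neg] at h

theorem mainTheorem7 (r : ℕ) (ν : Fin (r + 1) → ℕ) (q : Fin (r + 1) → ℕ)
    (hν_pos : ∀ k, 0 < ν k)
    (hν_distinct : Function.Injective ν)
    (hν_coprime : Pairwise fun j k => Nat.Coprime (ν j) (ν k))
    (hq : (∀ k, 1 < q k) ∨ (∀ k, Odd (∑ j ∈ Finset.univ.erase k, q j))) :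
    reciprocity (fun k => periodicBernoulli (q k)) ν = 0 := by
  refine Finset.sum_eq_zero fun k _ => ?_
  rcases hq with hq | hq
  · rw [jump_periodicBernoulli, if_neg (hq k).ne', mul_zero]
  · rw [dedekindSum_periodicBernoulli_eq_zero ν q hν_coprime k (hq k), zero_mul]
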